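/- Let $n\in\{2,3\}$. A Lipschitz domain is a bounded, connected, nonempty open set in $\mathbb R^n$ with Lipschitz boundary. Let $\widetilde\Omega$ and $F$ be Lipschitz domains with $\overline F\subset\widetilde\Omega$ (an internal feature) such that $\Omega=\widetilde\Omega\setminus\overline F$ is a Lipschitz domain. Put $\gamma=\partial F$, $\Gamma=\partial\widetilde\Omega$, let $m_F=|F|^{-1}\int_F x\,dx$ be the barycenter of $F$, and let $R=\operatorname{dist}(m_F,\Gamma)$. Suppose $R>0$ and $$s_\gamma:=\frac{\operatorname{diam}\gamma}{2\operatorname{dist}(m_F,\Gamma)}<1,\qquad \bar c_\gamma:=\begin{cases}\sqrt{\dfrac{2\pi}{|\log s_\gamma|}},& n=2,\\[2mm] \sqrt{\dfrac{2\pi\operatorname{diam}\gamma}{1-s_\gamma}},& n=3,\end{cases}$$ where $\operatorname{diam}$ is the Euclidean diameter. Let $1^\star$ be the function on $\partial\Omega=\gamma\cup\Gamma$ equal to $1$ on $\gamma$ and $0$ on $\Gamma$. For $\mu$ on $\partial\Omega$ write $$\|\mu\|_{\mathrm{nat}}=\inf\{\|v\|_{H^1(\Omega)}: v\in H^1(\Omega),\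 v|_{\partial\Omega}=\mu\},\qquad |\mu|_{\mathrm{nat}}=\inf\{\|\nabla v\|_{L^2(\Omega)}: v\in H^1(\Omega),\ v|_{\partial\Omega}=\mu\}.$$ For every $\theta\in(0,1]$ there is a constant $c>0$, depending only on $n$ and $\theta$, such that for all such $\widetilde\Omega$ and $F$ with $$\overline F\subset \overline{B}_{\rho}(m_F),\qquad \rho=\theta\,\tfrac{\operatorname{diam}\gamma}{2}+(1-\theta)R,$$ the constant function $1$ belongs to $H^{1/2}_{00}(\gamma)$, that is, $1\in L^2(\gamma)$ and $1^\star\in H^{1/2}(\partial\Omega)$ (square integrable with finite Gagliardo seminorm), and $$|1^\star|_{\mathrm{nat}}\le c\,\bar c_\gamma,\qquad \|1^\star\|_{\mathrm{nat}}\le c\,\sqrt{1+R^2}\;\bar c_\gamma .$$ (For $\theta=1$ the condition on $F$ reads $\overline F\subset\overline B_{\operatorname{diam}\gamma/2}(m_F)$; for $\theta<1$ it holds automatically if $s_\gamma\le\frac{1-\theta}{2-\theta}$, that is, for all sufficiently small features.) -/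

import Mathlib

open MeasureTheory Set Filter Topology
open scoped ENNReal NNReal ContDiff

namespace Defeaturing

/-- Euclidean space of dimension `n`. -/
abbrev Space (n : ℕ) := EuclideanSpace ℝ (Fin n)

/-- Lipschitz continuous boundary: a locally finite countable open cover `C` of the boundary with
covering radius `ε`, overlap bound `M` and Lipschitz bound `L`, such that in each `C k` the set
lies above a Lipschitz graph in suitable orthonormal coordinates `(y', y_n)`, given by a rigid
motion `e`. (Finite covers are padded by empty sets.) -/
def HasLipschitzBoundary {n : ℕ} (Ω : Set (Space n)) : Prop :=
  ∃ (ε : ℝ) (L : ℝ≥0) (M : ℕ) (C : ℕ → Set (Space n)),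
    0 < ε ∧ 0 < L ∧ (∀ k, IsOpen (C k)) ∧ LocallyFinite C ∧ frontier Ω ⊆ ⋃ k, C k ∧
    (∀ x ∈ frontier Ω, ∃ k, Metric.ball x ε ⊆ C k) ∧
    (∀ x, {k | x ∈ C k}.encard ≤ M) ∧
    ∀ k, ∃ (e : Space n ≃ᵢ WithLp 2 (Space (n - 1) × ℝ)) (f : Space (n - 1) → ℝ),
      LipschitzWith L f ∧ C k ∩ Ω = C k ∩ {x | f (e x).fst < (e x).snd}

/-- A (bounded, connected) Lipschitz domain. -/
structure IsLipschitzDomain {n : ℕ} (Ω : Set (Space n)) : Prop where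
  isOpen : IsOpen Ω
  isBounded : Bornology.IsBounded Ω
  isConnected : IsConnected Ω
  lipschitz : HasLipschitzBoundary Ω

/-- `F` is an internal negative feature of the defeatured domain `D`; the exact domain is
`D \ closure F`. -/
structure IsInternalFeature {n : ℕ} (D F : Set (Space n)) : Prop where
  defeatured : IsLipschitzDomain D
  feature : IsLipschitzDomain F
  exact : IsLipschitzDomain (D \ closure F)
  internal : closure F ⊆ D

/-- The surface measure on a subset `Λ` of the boundary of a domain: the `(n-1)`-dimensional
Hausdorff measure. -/
noncomputable def surface {n : ℕ} (Λ : Set (Space n)) : Measure (Space n) :=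
  (Measure.hausdorffMeasure ((n : ℝ) - 1)).restrict Λ

/-- `g` is the weak gradient of `v` on `Ω`. -/
def HasWeakGradient {n : ℕ} (Ω : Set (Space n)) (v : Space n → ℝ) (g : Space n → Space n) :
    Prop :=
  ∀ φ : Space n → ℝ, ContDiff ℝ ∞ φ → HasCompactSupport φ → tsupport φ ⊆ Ω → ∀ i : Fin n,
    ∫ x in Ω, v x * fderiv ℝ φ x (EuclideanSpace.single i 1) = - ∫ x in Ω, g x i * φ x

/-- `v` belongs to the Sobolev space `H¹(Ω)`, with weak gradient `g`. -/
structure IsH1 {n : ℕ} (Ω : Set (Space n)) (v : Space n → ℝ) (g : Space n → Space n) : Prop where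
  memLp : MemLp v 2 (volume.restrict Ω)
  memLp_grad : MemLp g 2 (volume.restrict Ω)
  weak : HasWeakGradient Ω v g

/-- The `H¹(Ω)` seminorm, in terms of the weak gradient. -/
noncomputable def h1Seminorm {n : ℕ} (Ω : Set (Space n)) (g : Space n → Space n) : ℝ≥0∞ :=
  eLpNorm g 2 (volume.restrict Ω)

/-- The full `H¹(Ω)` norm of `v` with weak gradient `g`. -/
noncomputable def h1Norm {n : ℕ} (Ω : Set (Space n)) (v : Space n → ℝ) (g : Space n → Space n) :
    ℝ≥0∞ :=
  (eLpNorm v 2 (volume.restrict Ω) ^ 2 + h1Seminorm Ω g ^ 2) ^ (1 / 2 : ℝ)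

/-- The trace on `∂Ω` of the `H¹(Ω)` function `v` with weak gradient `g` is `μ`. The trace operator
is the continuous extension of the restriction `φ ↦ φ|_{∂Ω}` of functions smooth up to the boundary,
which are dense in `H¹(Ω)` for a Lipschitz domain; its graph is the closure in
`H¹(Ω) × L²(∂Ω)` of the set of pairs `(φ|_Ω, φ|_{∂Ω})`. -/
def HasTrace {n : ℕ} (Ω : Set (Space n)) (v : Space n → ℝ) (g : Space n → Space n)
    (μ : Space n → ℝ) : Prop :=
  ∃ φ : ℕ → Space n → ℝ, (∀ k, ContDiff ℝ ∞ (φ k)) ∧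
    Tendsto (fun k => eLpNorm (fun x => φ k x - v x) 2 (volume.restrict Ω)) atTop (𝓝 0) ∧
    Tendsto (fun k => eLpNorm (fun x => gradient (φ k) x - g x) 2 (volume.restrict Ω))
      atTop (𝓝 0) ∧
    Tendsto (fun k => eLpNorm (fun x => φ k x - μ x) 2 (surface (frontier Ω))) atTop (𝓝 0)

/-- The natural norm of `μ` on `∂Ω`: the infimum of the full `H¹(Ω)` norms of the functions with
trace `μ` (it is `∞` if there are none). -/
noncomputable def naturalNorm {n : ℕ} (Ω : Set (Space n)) (μ : Space n → ℝ) : ℝ≥0∞ :=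
  ⨅ (v : Space n → ℝ) (g : Space n → Space n) (_ : IsH1 Ω v g) (_ : HasTrace Ω v g μ),
    h1Norm Ω v g

/-- The natural seminorm of `μ` on `∂Ω`: the infimum of the `H¹(Ω)` seminorms of the functions with
trace `μ` (it is `∞` if there are none). -/
noncomputable def naturalSeminorm {n : ℕ} (Ω : Set (Space n)) (μ : Space n → ℝ) : ℝ≥0∞ :=
  ⨅ (v : Space n → ℝ) (g : Space n → Space n) (_ : IsH1 Ω v g) (_ : HasTrace Ω v g μ),
    h1Seminorm Ω g

/-- `μ` belongs to `H^{1/2}(∂Ω)`: square integrable with finite Gagliardo seminorm. -/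
def MemHHalf {n : ℕ} (Ω : Set (Space n)) (μ : Space n → ℝ) : Prop :=
  MemLp μ 2 (surface (frontier Ω)) ∧
    ∫⁻ x, ∫⁻ y, ‖μ x - μ y‖ₑ ^ 2 / edist x y ^ n ∂(surface (frontier Ω))
      ∂(surface (frontier Ω)) < ⊤

/-- `μ` belongs to `H^{1/2}_{00}(Λ)` for `Λ ⊆ ∂Ω`: it is square integrable on `Λ` and its extension
by zero belongs to `H^{1/2}(∂Ω)`. -/
def MemHHalfZero {n : ℕ} (Ω Λ : Set (Space n)) (μ : Space n → ℝ) : Prop :=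
  MemLp μ 2 (surface Λ) ∧ MemHHalf Ω (Λ.indicator μ)

/-- The barycenter of `F`. -/
noncomputable def barycenter {n : ℕ} (F : Set (Space n)) : Space n := ⨍ x in F, x

/-- The distance of the barycenter of the feature from the outer boundary. -/
noncomputable def outerRadius {n : ℕ} (D F : Set (Space n)) : ℝ :=
  Metric.infDist (barycenter F) (frontier D)

/-- The relative feature size `s_γ = diam γ / (2 dist(m_F, ∂D))`, where `γ = ∂F`. -/
noncomputable def relSize {n : ℕ} (D F : Set (Space n)) : ℝ :=
  Metric.diam (frontier F) / (2 * outerRadius D F)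

/-- The constant `c̄_γ` in dimension `n = 2` and (otherwise) in dimension `n = 3`. -/
noncomputable def cBar {n : ℕ} (D F : Set (Space n)) : ℝ :=
  if n = 2 then √(2 * Real.pi / |Real.log (relSize D F)|)
  else √(2 * Real.pi * Metric.diam (frontier F) / (1 - relSize D F))

end Defeaturing

namespace Defeaturing

/-! The natural norms are infima, so one good extension of $1^\star$ suffices. Let $m$ be the
barycenter of $F$, $d=\operatorname{diam}\gamma$, and $r=\min(\theta d/2+(1-\theta)R,\,d)$. Then
$\overline F\subset\overline B_r(m)$ and $B_R(m)\subset\widetilde\Omega$, so a radial cutoff that is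
$1$ on $\overline B_r(m)$ and $0$ off $B_R(m)$ has the right trace. The cheapest one is the
capacitary potential of the annulus, $(q(|x-m|)-q(R))/(q(r)-q(R))$ with $q'=-t^{1-n}$. Composing it
with a smooth step costs only a constant $K$ and makes it $C^\infty$, so its classical gradient and
restriction serve as weak gradient and trace. Its energy and its squared $L^2$ norm are at most
constants times $1/(q(r)-q(R))$ and $R^2/(q(r)-q(R))$ (`exists_capacitary_cutoff`).

It remains to bound $1/(q(r)-q(R))$ by a multiple of $\bar c_\gamma^2$ (`log_gap`, `inv_gap`). The
first entry of the minimum keeps $r$ away from $R$ as $s_\gamma\to1$; the entry $d$, available since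
$m$ lies in the closed convex hull of $\gamma$, makes $r$ shrink with the feature. Membership in
$H^{1/2}_{00}(\gamma)$ is separate: $\gamma$ and $\Gamma$ are a positive distance apart and the
boundaries have finite surface measure. -/

/-! ### Smooth step and radial potentials. -/

theorem exists_smoothTransition_bound :
    ∃ K : ℝ, 0 < K ∧ (∀ u, |deriv Real.smoothTransition u| ≤ K) ∧
      ∀ u, 0 ≤ u → Real.smoothTransition u ≤ K * u := by
  have hc : Continuous (deriv Real.smoothTransition) :=
    (Real.smoothTransition.contDiff (n := 1)).continuous_deriv le_rfl
  obtain ⟨K, hK⟩ := isCompact_Icc.exists_bound_of_continuousOn (s := Icc (0 : ℝ) 1) hc.continuousOn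
  have hb : ∀ u, |deriv Real.smoothTransition u| ≤ max K 1 := by
    intro u
    rcases lt_or_ge u 0 with h | h
    · have : Real.smoothTransition =ᶠ[𝓝 u] fun _ => 0 := by
        filter_upwards [gt_mem_nhds h] with y hy using Real.smoothTransition.zero_of_nonpos hy.le
      simp [this.deriv_eq]
    rcases lt_or_ge 1 u with h' | h'
    · have : Real.smoothTransition =ᶠ[𝓝 u] fun _ => 1 := by
        filter_upwards [lt_mem_nhds h'] with y hy using Real.smoothTransition.one_of_one_le hy.le
      simp [this.deriv_eq]
    · exact (hK u ⟨h, h'⟩).trans (le_max_left _ _)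
  refine ⟨max K 1, by positivity, hb, fun u hu => ?_⟩
  have := Convex.norm_image_sub_le_of_norm_deriv_le (f := Real.smoothTransition) (s := univ)
    (x := 0) (y := u) (fun x _ => (Real.smoothTransition.contDiff (n := 1)).differentiable
      one_ne_zero x) (fun x _ => hb x) convex_univ trivial trivial
  simpa [Real.norm_eq_abs, abs_of_nonneg, hu, Real.smoothTransition.nonneg,
    Real.smoothTransition.zero] using this

/-- A radial profile `q` with `q' = - t^{1-n}`, that is, a multiple of the fundamental solution of
the Laplacian in dimension `n`. -/
structure IsRadialPotential (n : ℕ) (q : ℝ → ℝ) : Prop where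
  hasDerivAt : ∀ t, 0 < t → HasDerivAt q (-(t ^ (n - 1))⁻¹) t
  contDiffAt : ∀ t, 0 < t → ContDiffAt ℝ ∞ q t
  bound : ∀ t R, 0 < t → t ≤ R → t ^ (n - 1) * (q t - q R) ≤ R

theorem IsRadialPotential.strictAntiOn {n : ℕ} {q : ℝ → ℝ} (hq : IsRadialPotential n q) :
    StrictAntiOn q (Ioi 0) := by
  refine strictAntiOn_of_deriv_neg (convex_Ioi 0)
    (fun t ht => (hq.hasDerivAt t ht).continuousAt.continuousWithinAt) fun t ht => ?_
  rw [interior_Ioi] at ht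
  have ht : 0 < t := ht
  rw [(hq.hasDerivAt t ht).deriv]
  simp only [Left.neg_neg_iff]
  positivity

theorem isRadialPotential_two : IsRadialPotential 2 fun t => -Real.log t where
  hasDerivAt t ht := by
    have := (Real.hasDerivAt_log ht.ne').neg
    simp only [Nat.add_one_sub_one, pow_one]
    exact this
  contDiffAt t ht := (Real.contDiffAt_log.2 ht.ne').neg
  bound t R ht hR := by
    have hR0 : 0 < R := ht.trans_le hR
    have h : Real.log (R / t) ≤ R / t - 1 := Real.log_le_sub_one_of_pos (by positivity)
    rw [Real.log_div hR0.ne' ht.ne'] at h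
    have : t * (Real.log R - Real.log t) ≤ t * (R / t - 1) := by gcongr
    have e : t * (R / t - 1) = R - t := by field_simp
    simp only [Nat.add_one_sub_one, pow_one]
    linarith

theorem isRadialPotential_three : IsRadialPotential 3 fun t => t⁻¹ where
  hasDerivAt t ht := by simpa using hasDerivAt_inv ht.ne'
  contDiffAt t ht := contDiffAt_inv ℝ ht.ne'
  bound t R ht hR := by
    have hR0 : 0 < R := ht.trans_le hR
    have e : t ^ (3 - 1) * (t⁻¹ - R⁻¹) = t - t ^ 2 * R⁻¹ := by simp; field_simp
    have : 0 ≤ t ^ 2 * R⁻¹ := by positivity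
    linarith

/-- The radial profile of the capacitary cutoff of the annulus `r < |x| < R`. -/
noncomputable def cutoffProfile (q : ℝ → ℝ) (r R t : ℝ) : ℝ :=
  -- Both potentials blow up at $0$, but their Lean value there is $0$; the true limit $1$ of the
  -- profile is imposed by hand.
  if t = 0 then 1 else Real.smoothTransition ((q t - q R) / (q r - q R))

/-! ### One-dimensional estimates for the cutoff profile. -/

section Profile

variable {n : ℕ} {q : ℝ → ℝ} {r R t : ℝ}

theorem cutoffProfile_nonneg : 0 ≤ cutoffProfile q r R t := by
  unfold cutoffProfile
  split_ifs
  · exact zero_le_one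
  · exact Real.smoothTransition.nonneg _

theorem cutoffProfile_le_one : cutoffProfile q r R t ≤ 1 := by
  unfold cutoffProfile
  split_ifs
  · exact le_rfl
  · exact Real.smoothTransition.le_one _

theorem cutoffProfile_eq_one (hq : IsRadialPotential n q) (hr : 0 < r) (hrR : r < R)
    (ht : 0 ≤ t) (htr : t ≤ r) : cutoffProfile q r R t = 1 := by
  unfold cutoffProfile
  split_ifs with h
  · rfl
  · have hd : q R < q r := hq.strictAntiOn hr (hr.trans hrR : 0 < R) hrR
    have : q r ≤ q t := hq.strictAntiOn.antitoneOn (lt_of_le_of_ne ht (Ne.symm h) : 0 < t) hr htr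
    refine Real.smoothTransition.one_of_one_le ?_
    rw [one_le_div (by linarith)]
    linarith

theorem cutoffProfile_eq_zero (hq : IsRadialPotential n q) (hr : 0 < r) (hrR : r < R)
    (ht : R ≤ t) : cutoffProfile q r R t = 0 := by
  have hR : 0 < R := hr.trans hrR
  have hd : q R < q r := hq.strictAntiOn hr hR hrR
  have : q t ≤ q R := hq.strictAntiOn.antitoneOn hR (hR.trans_le ht : 0 < t) ht
  rw [cutoffProfile, if_neg (hR.trans_le ht).ne']
  exact Real.smoothTransition.zero_of_nonpos
    (div_nonpos_of_nonpos_of_nonneg (by linarith) (by linarith))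

theorem cutoffProfile_eventuallyEq (ht : 0 < t) : cutoffProfile q r R =ᶠ[𝓝 t]
    fun t => Real.smoothTransition ((q t - q R) / (q r - q R)) := by
  filter_upwards [lt_mem_nhds ht] with s hs
  rw [cutoffProfile, if_neg hs.ne']

theorem contDiffAt_cutoffProfile (hq : IsRadialPotential n q) (ht : 0 < t) :
    ContDiffAt ℝ ∞ (cutoffProfile q r R) t := by
  refine ContDiffAt.congr_of_eventuallyEq ?_ (cutoffProfile_eventuallyEq ht)
  exact (Real.smoothTransition.contDiff (n := ⊤)).contDiffAt.comp t
    (((hq.contDiffAt t ht).sub contDiffAt_const).div_const _)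

theorem abs_deriv_cutoffProfile_le (hq : IsRadialPotential n q) {K : ℝ}
    (hK : ∀ u, |deriv Real.smoothTransition u| ≤ K) (hr : 0 < r) (hrR : r < R) (ht : 0 < t) :
    |deriv (cutoffProfile q r R) t| ≤
      (Icc r R).indicator (fun t => K * (t ^ (n - 1))⁻¹ / (q r - q R)) t := by
  have hR : 0 < R := hr.trans hrR
  have hd : q R < q r := hq.strictAntiOn hr hR hrR
  by_cases h : t ∈ Icc r R
  · rw [indicator_of_mem h, (cutoffProfile_eventuallyEq ht).deriv_eq]
    have h1 : HasDerivAt (fun t => (q t - q R) / (q r - q R))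
        (-(t ^ (n - 1))⁻¹ / (q r - q R)) t := ((hq.hasDerivAt t ht).sub_const _).div_const _
    have h2 := ((Real.smoothTransition.contDiff (n := 1)).differentiable one_ne_zero
      ((q t - q R) / (q r - q R))).hasDerivAt.comp t h1
    rw [show (fun t => Real.smoothTransition ((q t - q R) / (q r - q R))) =
      Real.smoothTransition ∘ fun t => (q t - q R) / (q r - q R) from rfl, h2.deriv, abs_mul,
      mul_div_assoc]
    have : |-(t ^ (n - 1))⁻¹ / (q r - q R)| = (t ^ (n - 1))⁻¹ / (q r - q R) := by
      rw [abs_div, abs_neg, abs_of_pos (by positivity), abs_of_pos (sub_pos.2 hd)]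
    rw [this]
    have : 0 ≤ (t ^ (n - 1))⁻¹ / (q r - q R) := div_nonneg (by positivity) (by linarith)
    gcongr
    exact hK _
  · rw [indicator_of_notMem h]
    rcases lt_or_ge t r with h1 | h1
    · have : cutoffProfile q r R =ᶠ[𝓝 t] fun _ => 1 := by
        filter_upwards [lt_mem_nhds ht, gt_mem_nhds h1] with s hs hs'
          using cutoffProfile_eq_one hq hr hrR hs.le hs'.le
      simp [this.deriv_eq]
    · have h2 : R < t := by
        by_contra h2
        exact h ⟨h1, not_lt.1 h2⟩
      have : cutoffProfile q r R =ᶠ[𝓝 t] fun _ => 0 := by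
        filter_upwards [lt_mem_nhds h2] with s hs using cutoffProfile_eq_zero hq hr hrR hs.le
      simp [this.deriv_eq]

theorem cutoffProfile_le (hq : IsRadialPotential n q) {K : ℝ}
    (hK : ∀ u, 0 ≤ u → Real.smoothTransition u ≤ K * u) (hr : 0 < r) (hrR : r < R) (ht : 0 < t)
    (htR : t ≤ R) : cutoffProfile q r R t ≤ K * ((q t - q R) / (q r - q R)) := by
  have hR : 0 < R := hr.trans hrR
  have hd : q R < q r := hq.strictAntiOn hr hR hrR
  have : q R ≤ q t := hq.strictAntiOn.antitoneOn ht hR htR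
  rw [cutoffProfile, if_neg ht.ne']
  exact hK _ (div_nonneg (by linarith) (by linarith))

/-- Since $t^{n-1}(t^{1-n})^2=t^{1-n}=-q'$, the integral over $[r,R]$ is $q(r)-q(R)$, which cancels
one of the two such factors in the denominator. -/
theorem integrableOn_sq_deriv_bound (hq : IsRadialPotential n q) (K : ℝ) (hr : 0 < r)
    (hrR : r < R) :
    IntegrableOn (fun t => t ^ (n - 1) •
      ((Icc r R).indicator (fun t => K * (t ^ (n - 1))⁻¹ / (q r - q R)) t) ^ 2) (Ioi 0) ∧
    ∫ t in Ioi 0, t ^ (n - 1) •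
      ((Icc r R).indicator (fun t => K * (t ^ (n - 1))⁻¹ / (q r - q R)) t) ^ 2 =
      K ^ 2 / (q r - q R) := by
  have hR : 0 < R := hr.trans hrR
  have hd : 0 < q r - q R := sub_pos.2 (hq.strictAntiOn hr hR hrR)
  have e : (fun t => t ^ (n - 1) •
      ((Icc r R).indicator (fun t => K * (t ^ (n - 1))⁻¹ / (q r - q R)) t) ^ 2) =
      (Icc r R).indicator (fun t => K ^ 2 / (q r - q R) ^ 2 * (t ^ (n - 1))⁻¹) := by
    ext t
    by_cases h : t ∈ Icc r R
    · have : 0 < t := hr.trans_le h.1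
      simp only [indicator_of_mem h, smul_eq_mul]
      field_simp
    · simp [indicator_of_notMem h]
  have hc : ContinuousOn (fun t : ℝ => (t ^ (n - 1))⁻¹) (Icc r R) :=
    (continuousOn_id.pow _).inv₀ fun t ht => (pow_pos (hr.trans_le ht.1) _).ne'
  have hi : IntegrableOn (fun t : ℝ => K ^ 2 / (q r - q R) ^ 2 * (t ^ (n - 1))⁻¹) (Icc r R) :=
    (continuousOn_const.mul hc).integrableOn_compact isCompact_Icc
  rw [e]
  refine ⟨((integrable_indicator_iff measurableSet_Icc).2 hi).integrableOn, ?_⟩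
  have hsub : Icc r R ⊆ Ioi 0 := fun t ht => hr.trans_le ht.1
  rw [setIntegral_indicator measurableSet_Icc, inter_eq_self_of_subset_right hsub,
    integral_const_mul,
    integral_Icc_eq_integral_Ioc, ← intervalIntegral.integral_of_le hrR.le]
  have := intervalIntegral.integral_eq_sub_of_hasDerivAt (a := r) (b := R) (f := fun t => - q t)
    (f' := fun t => (t ^ (n - 1))⁻¹)
    (fun t ht => by
      rw [uIcc_of_le hrR.le] at ht
      have := (hq.hasDerivAt t (hr.trans_le ht.1)).neg
      rw [neg_neg] at this
      exact this)
    (ContinuousOn.intervalIntegrable (by rwa [uIcc_of_le hrR.le]))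
  rw [this]
  field_simp
  ring

end Profile

/-! ### The capacitary cutoff in space. -/

theorem integral_radial_translate {n : ℕ} (m : Space n) (f : ℝ → ℝ) [Nontrivial (Space n)]
    (hf : IntegrableOn (fun y : ℝ => y ^ (n - 1) • f y) (Ioi 0)) :
    Integrable (fun x : Space n => f ‖x - m‖) ∧
    ∫ x : Space n, f ‖x - m‖ =
      n * volume.real (Metric.ball (0 : Space n) 1) * ∫ y in Ioi (0 : ℝ), y ^ (n - 1) • f y := by
  constructor
  · exact Integrable.comp_sub_right ((integrable_fun_norm_addHaar (volume : Measure (Space n))).2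
      (by simpa using hf)) m
  · rw [integral_sub_right_eq_self (fun x : Space n => f ‖x‖) m,
      integral_fun_norm_addHaar (volume : Measure (Space n)) f]
    simp [mul_assoc]

theorem exists_capacitary_cutoff {n : ℕ} [Nontrivial (Space n)] {q : ℝ → ℝ}
    (hq : IsRadialPotential n q) {K : ℝ} (hK0 : 0 < K)
    (hK : ∀ u, |deriv Real.smoothTransition u| ≤ K)
    (hK' : ∀ u, 0 ≤ u → Real.smoothTransition u ≤ K * u) {r R : ℝ} (hr : 0 < r) (hrR : r < R)
    (m : Space n) :
    ∃ φ : Space n → ℝ, ContDiff ℝ ∞ φ ∧ HasCompactSupport φ ∧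
      (∀ x ∈ Metric.closedBall m r, φ x = 1) ∧ (∀ x ∉ Metric.ball m R, φ x = 0) ∧
      ∫ x, ‖gradient φ x‖ ^ 2 ≤
        n * volume.real (Metric.ball (0 : Space n) 1) * (K ^ 2 / (q r - q R)) ∧
      ∫ x, ‖φ x‖ ^ 2 ≤
        n * volume.real (Metric.ball (0 : Space n) 1) * (K * R ^ 2 / (q r - q R)) := by
  have hR : 0 < R := hr.trans hrR
  have hd : 0 < q r - q R := sub_pos.2 (hq.strictAntiOn hr hR hrR)
  set φ : Space n → ℝ := fun x => cutoffProfile q r R ‖x - m‖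
  have h1 : ∀ x ∈ Metric.closedBall m r, φ x = 1 := fun x hx =>
    cutoffProfile_eq_one hq hr hrR (norm_nonneg _) (by simpa [dist_eq_norm] using hx)
  have h0 : ∀ x ∉ Metric.ball m R, φ x = 0 := fun x hx =>
    cutoffProfile_eq_zero hq hr hrR (by simpa [dist_eq_norm] using hx)
  have hnear : φ =ᶠ[𝓝 m] fun _ => 1 := by
    filter_upwards [Metric.closedBall_mem_nhds m hr] with x hx using h1 x hx
  have hs : ContDiff ℝ ∞ φ := by
    rw [contDiff_iff_contDiffAt]
    intro x
    by_cases hx : x = m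
    · subst hx
      exact contDiffAt_const.congr_of_eventuallyEq hnear
    · have : x - m ≠ 0 := sub_ne_zero.2 hx
      exact (contDiffAt_cutoffProfile hq (norm_pos_iff.2 this)).comp x
        ((contDiffAt_id.sub contDiffAt_const).norm ℝ this)
  have hcs : HasCompactSupport φ :=
    HasCompactSupport.intro (isCompact_closedBall m R) fun x hx =>
      h0 x fun h => hx (Metric.ball_subset_closedBall h)
  refine ⟨φ, hs, hcs, h1, h0, ?_, ?_⟩
  · set G : ℝ → ℝ := (Icc r R).indicator fun t => K * (t ^ (n - 1))⁻¹ / (q r - q R)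
    obtain ⟨hi, he⟩ := integrableOn_sq_deriv_bound hq K hr hrR
    obtain ⟨hi', he'⟩ := integral_radial_translate m (fun t => G t ^ 2) hi
    rw [← he, ← he']
    refine integral_mono_of_nonneg (Eventually.of_forall fun x => by positivity) hi'
      (Eventually.of_forall fun x => ?_)
    show ‖gradient φ x‖ ^ 2 ≤ G ‖x - m‖ ^ 2
    have hn : ‖gradient φ x‖ = ‖fderiv ℝ φ x‖ := by simp [gradient]
    rw [hn]
    by_cases hx : x = m
    · subst hx
      rw [hnear.fderiv_eq]
      simpa using sq_nonneg _
    · have hx' : x - m ≠ 0 := sub_ne_zero.2 hx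
      have hpos := norm_pos_iff.2 hx'
      have hd1 : HasDerivAt (cutoffProfile q r R) (deriv (cutoffProfile q r R) ‖x - m‖) ‖x - m‖ :=
        ((contDiffAt_cutoffProfile hq hpos).differentiableAt (by simp)).hasDerivAt
      have hd2 : DifferentiableAt ℝ (fun x : Space n => ‖x - m‖) x :=
        ((contDiffAt_id.sub contDiffAt_const).norm ℝ hx' :
          ContDiffAt ℝ 1 (fun x : Space n => ‖x - m‖) x).differentiableAt one_ne_zero
      have hl : ‖fderiv ℝ (fun x : Space n => ‖x - m‖) x‖ ≤ 1 := by
        have : LipschitzWith 1 (fun x : Space n => ‖x - m‖) := by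
          simpa [dist_eq_norm] using LipschitzWith.dist_left m
        simpa using norm_fderiv_le_of_lipschitz ℝ this (x₀ := x)
      have := (hd1.comp_hasFDerivAt x hd2.hasFDerivAt).fderiv
      rw [show φ = cutoffProfile q r R ∘ fun x => ‖x - m‖ from rfl, this, norm_smul]
      have hb := abs_deriv_cutoffProfile_le hq hK hr hrR hpos
      gcongr
      calc _ ≤ ‖deriv (cutoffProfile q r R) ‖x - m‖‖ * 1 := by gcongr
        _ ≤ _ := by rw [mul_one]; exact hb
  -- The majorant comes from $\varphi^2\le\varphi$, the linear bound on the smooth step, and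
  -- $q(t)-q(R)\le R\,t^{1-n}$. Its weighted radial density is constant on $(0,R]$, which gives the
  -- factor $R^2$.
  · set H : ℝ → ℝ := (Ioc 0 R).indicator fun t => K * R / (q r - q R) * (t ^ (n - 1))⁻¹ with hH
    have e : (fun t => t ^ (n - 1) • H t) =
        (Ioc 0 R).indicator fun _ => K * R / (q r - q R) := by
      ext t
      by_cases h : t ∈ Ioc 0 R
      · have : 0 < t := h.1
        simp only [hH, indicator_of_mem h, smul_eq_mul]
        field_simp
      · simp [hH, indicator_of_notMem h]
    have hi : IntegrableOn (fun t => t ^ (n - 1) • H t) (Ioi 0) := by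
      rw [e]
      refine ((integrable_indicator_iff measurableSet_Ioc).2 ?_).integrableOn
      exact integrableOn_const (by simp)
    obtain ⟨hi', he'⟩ := integral_radial_translate m H hi
    rw [e, setIntegral_indicator measurableSet_Ioc,
      inter_eq_self_of_subset_right (fun t ht => ht.1)] at he'
    have e2 : ∫ t in Ioc 0 R, K * R / (q r - q R) = K * R ^ 2 / (q r - q R) := by
      simp [hR.le]
      ring
    rw [← e2, ← he']
    -- The centre must be excluded: there `H` vanishes while $\varphi=1$.
    have hae : ∀ᵐ x : Space n, x ≠ m := by
      simp [ae_iff]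
    refine integral_mono_of_nonneg (Eventually.of_forall fun x => by positivity) hi' ?_
    filter_upwards [hae] with x hx
    have hpos := norm_pos_iff.2 (sub_ne_zero.2 hx)
    rw [Real.norm_of_nonneg cutoffProfile_nonneg]
    by_cases h : ‖x - m‖ ≤ R
    · simp only [hH, indicator_of_mem (show ‖x - m‖ ∈ Ioc 0 R from ⟨hpos, h⟩)]
      calc φ x ^ 2 ≤ φ x := by
            rw [sq]
            exact mul_le_of_le_one_left cutoffProfile_nonneg cutoffProfile_le_one
        _ ≤ K * ((q ‖x - m‖ - q R) / (q r - q R)) := cutoffProfile_le hq hK' hr hrR hpos h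
        _ = K / (q r - q R) * ‖x - m‖ ^ (n - 1) * (q ‖x - m‖ - q R) * (‖x - m‖ ^ (n - 1))⁻¹ := by
            field_simp
        _ = K / (q r - q R) * (‖x - m‖ ^ (n - 1) * (q ‖x - m‖ - q R)) * (‖x - m‖ ^ (n - 1))⁻¹ := by
            ring
        _ ≤ K / (q r - q R) * R * (‖x - m‖ ^ (n - 1))⁻¹ := by
            gcongr
            exact hq.bound _ _ hpos h
        _ = _ := by ring
    · have : φ x = 0 := h0 x (by simpa [dist_eq_norm] using (not_le.1 h).le)
      have hH0 : H ‖x - m‖ = 0 := indicator_of_notMem (fun h' => h h'.2) _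
      rw [hH0]
      change φ x ^ 2 ≤ 0
      simp [this]

/-! ### Smooth functions as competitors for the natural norms. -/

theorem isH1_of_contDiff {n : ℕ} (Ω : Set (Space n)) {φ : Space n → ℝ} (hs : ContDiff ℝ ∞ φ)
    (hc : HasCompactSupport φ) : IsH1 Ω φ (gradient φ) := by
  have hg : Continuous (gradient φ) :=
    (InnerProductSpace.toDual ℝ (Space n)).symm.continuous.comp (hs.continuous_fderiv (by simp))
  have hgc : HasCompactSupport (gradient φ) :=
    (hc.fderiv ℝ).comp_left (map_zero (InnerProductSpace.toDual ℝ (Space n)).symm)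
  refine ⟨(hs.continuous.memLp_of_hasCompactSupport hc).restrict _,
    (hg.memLp_of_hasCompactSupport hgc).restrict _, ?_⟩
  intro ψ hψ hψc hψΩ i
  have hgi : ∀ x, gradient φ x i = fderiv ℝ φ x (EuclideanSpace.single i 1) := by
    intro x
    rw [← InnerProductSpace.toDual_symm_apply, ← gradient, EuclideanSpace.inner_single_right]
    simp
  have hψ0 : ∀ x ∉ Ω, ψ x = 0 := fun x hx => image_eq_zero_of_notMem_tsupport fun h => hx (hψΩ h)
  have hψ1 : ∀ x ∉ Ω, fderiv ℝ ψ x = 0 := fun x hx =>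
    image_eq_zero_of_notMem_tsupport fun h => hx (hψΩ (tsupport_fderiv_subset ℝ h))
  -- The test function is supported in $\Omega$, so both integrals extend to the whole space, where
  -- integration by parts has no boundary term.
  rw [setIntegral_eq_integral_of_forall_compl_eq_zero (fun x hx => by simp [hψ1 x hx]),
    setIntegral_eq_integral_of_forall_compl_eq_zero (fun x hx => by simp [hψ0 x hx])]
  simp only [hgi]
  have c1 : Continuous fun x => fderiv ℝ φ x (EuclideanSpace.single i 1) :=
    (hs.continuous_fderiv (by simp)).clm_apply continuous_const
  have c2 : Continuous fun x => fderiv ℝ ψ x (EuclideanSpace.single i 1) :=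
    (hψ.continuous_fderiv (by simp)).clm_apply continuous_const
  exact integral_mul_fderiv_eq_neg_fderiv_mul_of_integrable
    ((c1.mul hψ.continuous).integrable_of_hasCompactSupport hψc.mul_left)
    ((hs.continuous.mul c2).integrable_of_hasCompactSupport hc.mul_right)
    ((hs.continuous.mul hψ.continuous).integrable_of_hasCompactSupport hc.mul_right)
    (fun x _ => hs.differentiable (by simp) x) (fun x _ => hψ.differentiable (by simp) x)

theorem hasTrace_of_eqOn {n : ℕ} {Ω : Set (Space n)} {φ μ : Space n → ℝ} (hs : ContDiff ℝ ∞ φ)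
    (h : EqOn φ μ (frontier Ω)) : HasTrace Ω φ (gradient φ) μ := by
  refine ⟨fun _ => φ, fun _ => hs, by simp, by simp, ?_⟩
  have : eLpNorm (fun x => φ x - μ x) 2 (surface (frontier Ω)) = 0 := by
    rw [eLpNorm_congr_ae (g := fun _ => 0)]
    · simp
    · refine (ae_restrict_iff' isClosed_frontier.measurableSet).2 (Eventually.of_forall ?_)
      intro x hx
      simp [h hx]
  simp [this]

theorem eLpNorm_two_sq_le {n : ℕ} {E : Type*} [NormedAddCommGroup E] (Ω : Set (Space n))
    {f : Space n → E} (hf : Continuous f) (hc : HasCompactSupport f) {A : ℝ}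
    (hA : ∫ x, ‖f x‖ ^ 2 ≤ A) :
    eLpNorm f 2 (volume.restrict Ω) ^ 2 ≤ ENNReal.ofReal A := by
  calc eLpNorm f 2 (volume.restrict Ω) ^ 2 ≤ eLpNorm f 2 volume ^ 2 := by
        gcongr
        exact Measure.restrict_le_self
    _ = ENNReal.ofReal (∫ x, ‖f x‖ ^ 2) := by
        rw [(hf.memLp_of_hasCompactSupport hc).eLpNorm_eq_integral_rpow_norm two_ne_zero (by simp),
          ← ENNReal.ofReal_pow (by positivity)]
        congr 1
        simp only [ENNReal.toReal_ofNat, Real.rpow_ofNat]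
        rw [← one_div, ← Real.sqrt_eq_rpow, Real.sq_sqrt (by positivity)]
    _ ≤ _ := ENNReal.ofReal_le_ofReal hA

theorem natural_le_of_contDiff {n : ℕ} {Ω : Set (Space n)} {φ μ : Space n → ℝ}
    (hs : ContDiff ℝ ∞ φ) (hc : HasCompactSupport φ) (h : EqOn φ μ (frontier Ω)) {A B : ℝ}
    (hA0 : 0 ≤ A) (hB0 : 0 ≤ B)
    (hA : ∫ x, ‖gradient φ x‖ ^ 2 ≤ A ^ 2) (hB : ∫ x, ‖φ x‖ ^ 2 ≤ B ^ 2 - A ^ 2) :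
    naturalSeminorm Ω μ ≤ ENNReal.ofReal A ∧ naturalNorm Ω μ ≤ ENNReal.ofReal B := by
  have hg : Continuous (gradient φ) :=
    (InnerProductSpace.toDual ℝ (Space n)).symm.continuous.comp (hs.continuous_fderiv (by simp))
  have hgc : HasCompactSupport (gradient φ) :=
    (hc.fderiv ℝ).comp_left (map_zero (InnerProductSpace.toDual ℝ (Space n)).symm)
  have h1 : h1Seminorm Ω (gradient φ) ^ 2 ≤ ENNReal.ofReal (A ^ 2) := eLpNorm_two_sq_le Ω hg hgc hA
  have h2 := eLpNorm_two_sq_le Ω hs.continuous hc hB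
  have hBA : 0 ≤ B ^ 2 - A ^ 2 := (integral_nonneg fun x => by positivity).trans hB
  constructor
  · refine (iInf₂_le_of_le φ (gradient φ) (iInf₂_le (isH1_of_contDiff Ω hs hc)
      (hasTrace_of_eqOn hs h))).trans ?_
    rw [ENNReal.ofReal_pow hA0] at h1
    exact (ENNReal.pow_le_pow_left_iff two_ne_zero).1 h1
  · refine (iInf₂_le_of_le φ (gradient φ) (iInf₂_le (isH1_of_contDiff Ω hs hc)
      (hasTrace_of_eqOn hs h))).trans ?_
    calc h1Norm Ω φ (gradient φ)
        ≤ (ENNReal.ofReal (B ^ 2 - A ^ 2) + ENNReal.ofReal (A ^ 2)) ^ (1 / 2 : ℝ) := by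
          unfold h1Norm
          gcongr
      _ = (ENNReal.ofReal (B ^ 2)) ^ (1 / 2 : ℝ) := by
          rw [← ENNReal.ofReal_add hBA (by positivity), sub_add_cancel]
      _ = ENNReal.ofReal B := by
          rw [ENNReal.ofReal_rpow_of_nonneg (by positivity) (by positivity), ← Real.sqrt_eq_rpow,
            Real.sqrt_sq hB0]

/-! ### Location of the feature and of the ball around its barycenter. -/

/-- A half-line is connected and unbounded; if it never met the boundary it would stay in the
bounded set $F$. -/
theorem exists_ray_mem_frontier {E : Type*} [NormedAddCommGroup E] [NormedSpace ℝ E] {F : Set E}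
    (hF : IsOpen F) (hb : Bornology.IsBounded F) {x v : E} (hx : x ∈ F) (hv : v ≠ 0) :
    ∃ a : ℝ, 0 < a ∧ x + a • v ∈ frontier F := by
  by_contra! hcon
  have hpre : IsPreconnected ((fun a : ℝ => x + a • v) '' Ici 0) :=
    isPreconnected_Ici.image _ (by fun_prop)
  have hsub : (fun a : ℝ => x + a • v) '' Ici 0 ⊆ F := by
    refine hpre.subset_of_closure_inter_subset hF ⟨x, ⟨0, by simp⟩, hx⟩ ?_
    rintro _ ⟨h, a, ha, rfl⟩
    rcases eq_or_lt_of_le (show (0 : ℝ) ≤ a from ha) with rfl | ha'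
    · simpa using hx
    · by_contra h'
      exact hcon a ha' ⟨h, by rwa [hF.interior_eq]⟩
  obtain ⟨C, hC⟩ := hb.subset_closedBall x
  have hv' : 0 < ‖v‖ := norm_pos_iff.2 hv
  have h := hC (hsub ⟨(|C| + 1) / ‖v‖, by simp only [mem_Ici]; positivity, rfl⟩)
  rw [mem_closedBall_iff_norm, add_sub_cancel_left, norm_smul, Real.norm_of_nonneg (by positivity),
    div_mul_cancel₀ _ hv'.ne'] at h
  linarith [le_abs_self C]

/-- Two opposite rays from a point of $F$ hit the boundary, and the point lies on the segment
between the hits. -/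
theorem subset_convexHull_frontier {E : Type*} [NormedAddCommGroup E] [NormedSpace ℝ E]
    [Nontrivial E] {F : Set E} (hF : IsOpen F) (hb : Bornology.IsBounded F) :
    F ⊆ convexHull ℝ (frontier F) := by
  intro x hx
  obtain ⟨v, hv⟩ := exists_ne (0 : E)
  obtain ⟨a, ha, hxa⟩ := exists_ray_mem_frontier hF hb hx hv
  obtain ⟨b, hb0, hxb⟩ := exists_ray_mem_frontier hF hb hx (neg_ne_zero.2 hv)
  refine (segment_subset_convexHull hxa hxb) ⟨b / (a + b), a / (a + b), by positivity,
    by positivity, by field_simp; ring, ?_⟩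
  match_scalars
  · field_simp
    ring
  · field_simp
    ring

/-- The closed convex hull of $\partial F$ contains both $\overline F$ and the barycenter, and has
the same diameter as $\partial F$. -/
theorem closure_subset_closedBall_barycenter {n : ℕ} [Nontrivial (Space n)] {F : Set (Space n)}
    (hF : IsOpen F) (hb : Bornology.IsBounded F) (hne : F.Nonempty) :
    closure F ⊆ Metric.closedBall (barycenter F) (Metric.diam (frontier F)) := by
  set S := closure (convexHull ℝ (frontier F))
  have hFS : F ⊆ S := (subset_convexHull_frontier hF hb).trans subset_closure
  have hfb : Bornology.IsBounded (frontier F) := hb.closure.subset frontier_subset_closure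
  have hSb : Bornology.IsBounded S := ((isBounded_convexHull).2 hfb).closure
  have hm : barycenter F ∈ S := by
    refine (convex_convexHull ℝ _).closure.set_average_mem isClosed_closure
      (hF.measure_pos volume hne).ne' hb.measure_lt_top.ne ?_ ?_
    · exact (ae_restrict_iff' hF.measurableSet).2 (Eventually.of_forall fun x hx => hFS hx)
    · exact (continuous_id.continuousOn.integrableOn_compact hb.isCompact_closure).mono_set
        subset_closure
  intro x hx
  have hxS : x ∈ S := closure_minimal hFS isClosed_closure hx
  have := Metric.dist_le_diam_of_mem hSb hxS hm
  rwa [Metric.diam_closure, convexHull_diam] at this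

/-- The ball is connected and contains no boundary point of $D$, so one common point with $D$
suffices. The barycenter itself is not assumed to lie in $D$. -/
theorem ball_outerRadius_subset {n : ℕ} {D F : Set (Space n)} (hD : IsOpen D) {x : Space n}
    (hx : x ∈ D) (hxm : dist x (barycenter F) < outerRadius D F) :
    Metric.ball (barycenter F) (outerRadius D F) ⊆ D := by
  refine (convex_ball _ _).isPreconnected.subset_of_closure_inter_subset hD ⟨x, hxm, hx⟩ ?_
  rintro y ⟨hy, hyb⟩
  by_contra h
  have h1 : y ∈ frontier D := ⟨hy, by rwa [hD.interior_eq]⟩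
  have h2 : outerRadius D F ≤ dist (barycenter F) y := Metric.infDist_le_dist_of_mem h1
  rw [Metric.mem_ball, dist_comm] at hyb
  linarith

/-! ### Finite surface measure and membership in $H^{1/2}_{00}$. -/

theorem mem_graph_of_mem_frontier {n : ℕ} {Ω C : Set (Space n)} (hΩ : IsOpen Ω) (hC : IsOpen C)
    {e : Space n ≃ᵢ WithLp 2 (Space (n - 1) × ℝ)} {f : Space (n - 1) → ℝ} (hf : Continuous f)
    (h : C ∩ Ω = C ∩ {x | f (e x).fst < (e x).snd}) {x : Space n} (hx : x ∈ frontier Ω)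
    (hxC : x ∈ C) : (e x).snd = f (e x).fst := by
  have c1 : Continuous fun x => f (e x).fst :=
    hf.comp ((WithLp.prod_continuous_ofLp 2 _ _).comp e.continuous).fst
  have c2 : Continuous fun x => (e x).snd :=
    ((WithLp.prod_continuous_ofLp 2 _ _).comp e.continuous).snd
  apply le_antisymm
  · by_contra! hlt
    have : x ∈ C ∩ Ω := h ▸ ⟨hxC, hlt⟩
    exact hx.2 (by rw [hΩ.interior_eq]; exact this.2)
  · have h1 : x ∈ closure (C ∩ Ω) := hC.inter_closure ⟨hxC, hx.1⟩
    rw [h] at h1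
    have : closure (C ∩ {x | f (e x).fst < (e x).snd}) ⊆ {x | f (e x).fst ≤ (e x).snd} :=
      closure_minimal (fun y hy => (show f (e y).fst < (e y).snd from hy.2).le) (isClosed_le c1 c2)
    exact this h1

/-- Near each point the boundary lies in the Lipschitz image of a ball of $\mathbb R^{n-1}$;
compactness makes the local finiteness global. -/
theorem hausdorffMeasure_frontier_lt_top {n : ℕ} (hn : 1 ≤ n) {Ω : Set (Space n)}
    (h : IsLipschitzDomain Ω) : μH[(n : ℝ) - 1] (frontier Ω) < ⊤ := by
  have hcomp : IsCompact (frontier Ω) :=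
    Metric.isCompact_of_isClosed_isBounded isClosed_frontier
      (h.isBounded.closure.subset frontier_subset_closure)
  obtain ⟨ε, L, M, C, -, -, hCo, -, hcov, -, -, hloc⟩ := h.lipschitz
  refine hcomp.measure_lt_top_of_nhdsWithin fun x hx => ?_
  obtain ⟨k, hk⟩ := mem_iUnion.1 (hcov hx)
  obtain ⟨e, f, hf, hef⟩ := hloc k
  set g : Space (n - 1) → Space n := fun y => e.symm (WithLp.toLp 2 (y, f y)) with hg
  have hgl := e.symm.isometry.lipschitz.comp
    ((WithLp.prod_lipschitzWith_toLp 2 (Space (n - 1)) ℝ).comp (LipschitzWith.id.prodMk hf))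
  set s : Set (Space (n - 1)) := Metric.ball (e x).fst 1
  have hfin : μH[(n : ℝ) - 1] s < ⊤ := by
    have e1 : (n : ℝ) - 1 = (Module.finrank ℝ (Space (n - 1)) : ℝ) := by
      simp [Nat.cast_sub hn]
    rw [e1]
    exact Metric.isBounded_ball.measure_lt_top
  refine ⟨frontier Ω ∩ (C k ∩ {y | (e y).fst ∈ s}), ?_, ?_⟩
  · refine inter_mem_nhdsWithin _ (inter_mem ((hCo k).mem_nhds hk) ?_)
    have : Continuous fun y => (e y).fst :=
      ((WithLp.prod_continuous_ofLp 2 _ _).comp e.continuous).fst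
    exact this.continuousAt.preimage_mem_nhds (Metric.ball_mem_nhds _ one_pos)
  · have hsub : frontier Ω ∩ (C k ∩ {y | (e y).fst ∈ s}) ⊆ g '' s := by
      rintro y ⟨hy, hyC, hys⟩
      refine ⟨(e y).fst, hys, ?_⟩
      have := mem_graph_of_mem_frontier h.isOpen (hCo k) hf.continuous hef hy hyC
      rw [hg]
      simp only
      rw [← this]
      exact e.symm_apply_apply y
    refine (measure_mono hsub).trans_lt ?_
    have hd : (0 : ℝ) ≤ (n : ℝ) - 1 := by
      have : (1 : ℝ) ≤ n := by exact_mod_cast hn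
      linarith
    refine (hgl.hausdorffMeasure_image_le hd s).trans_lt ?_
    exact ENNReal.mul_lt_top (ENNReal.rpow_lt_top_of_nonneg hd ENNReal.coe_ne_top) hfin

theorem frontier_diff_closure_subset {n : ℕ} (D F : Set (Space n)) :
    frontier (D \ closure F) ⊆ frontier D ∪ frontier F := by
  rw [sdiff_eq]
  refine (frontier_inter_subset _ _).trans ?_
  rw [frontier_compl]
  exact union_subset_union inter_subset_left
    (inter_subset_right.trans frontier_closure_subset)

theorem memHHalfZero_one {n : ℕ} (hn : 1 ≤ n) {D F : Set (Space n)} (h : IsInternalFeature D F) :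
    MemHHalfZero (D \ closure F) (frontier F) fun _ => 1 := by
  have hγ := hausdorffMeasure_frontier_lt_top hn h.feature
  have hΩ := hausdorffMeasure_frontier_lt_top hn h.exact
  have : IsFiniteMeasure (surface (frontier F)) := ⟨by simpa [surface] using hγ⟩
  have : IsFiniteMeasure (surface (frontier (D \ closure F))) := ⟨by simpa [surface] using hΩ⟩
  have hmeas : MeasurableSet (frontier F) := isClosed_frontier.measurableSet
  refine ⟨memLp_const 1, (memLp_const 1).indicator hmeas, ?_⟩
  have hFc : IsCompact (frontier F) :=
    Metric.isCompact_of_isClosed_isBounded isClosed_frontier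
      (h.feature.isBounded.closure.subset frontier_subset_closure)
  have hdisj : Disjoint (frontier F) (frontier D) := by
    rw [Set.disjoint_left]
    intro x hxF hxD
    rw [h.defeatured.isOpen.frontier_eq] at hxD
    exact hxD.2 (h.internal (frontier_subset_closure hxF))
  obtain ⟨δ, hδ0, hδ⟩ := hFc.exists_thickening_subset_open
    (isClosed_frontier (s := D)).isOpen_compl (disjoint_left.1 hdisj)
  have hdist : ∀ x ∈ frontier F, ∀ y ∈ frontier D, ENNReal.ofReal δ ≤ edist x y := by
    intro x hx y hy
    by_contra! hlt
    refine hδ (Metric.mem_thickening_iff.2 ⟨x, hx, ?_⟩) hy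
    rw [edist_dist, ENNReal.ofReal_lt_ofReal_iff hδ0, dist_comm] at hlt
    exact hlt
  -- The numerator vanishes unless one point is on $\gamma$ and the other on $\Gamma$, where the
  -- distance is at least $\delta$; so the Gagliardo kernel is bounded.
  have hb : ∀ x ∈ frontier (D \ closure F), ∀ y ∈ frontier (D \ closure F),
      ‖(frontier F).indicator (fun _ => (1 : ℝ)) x - (frontier F).indicator (fun _ => 1) y‖ₑ ^ 2 /
        edist x y ^ n ≤ 1 / ENNReal.ofReal δ ^ n := by
    intro x hx y hy
    by_cases hxF : x ∈ frontier F <;> by_cases hyF : y ∈ frontier F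
    · simp [hxF, hyF]
    · have hyD : y ∈ frontier D := (frontier_diff_closure_subset D F hy).resolve_right hyF
      simp only [indicator_of_mem hxF, indicator_of_notMem hyF, sub_zero, enorm_one, one_pow]
      gcongr
      exact hdist x hxF y hyD
    · have hxD : x ∈ frontier D := (frontier_diff_closure_subset D F hx).resolve_right hxF
      simp only [indicator_of_mem hyF, indicator_of_notMem hxF, zero_sub, enorm_neg, enorm_one,
        one_pow]
      gcongr
      rw [edist_comm]
      exact hdist y hyF x hxD
    · simp [hxF, hyF]
  have hmΩ : MeasurableSet (frontier (D \ closure F)) := isClosed_frontier.measurableSet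
  calc _ ≤ ∫⁻ _ : Space n, ∫⁻ _ : Space n, 1 / ENNReal.ofReal δ ^ n
          ∂(surface (frontier (D \ closure F))) ∂(surface (frontier (D \ closure F))) := by
        refine setLIntegral_mono' hmΩ fun x hx => setLIntegral_mono' hmΩ fun y hy => hb x hx y hy
    _ < ⊤ := by
        simp only [lintegral_const]
        have : 1 / ENNReal.ofReal δ ^ n < ⊤ :=
          ENNReal.div_lt_top ENNReal.one_ne_top (pow_ne_zero _ (by simpa using hδ0))
        exact ENNReal.mul_lt_top (ENNReal.mul_lt_top this (measure_lt_top _ _)) (measure_lt_top _ _)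

/-! ### Comparison of the potential gap with $\bar c_\gamma$. -/

section Radii

variable {θ d R : ℝ}

theorem one_sub_min_radius_div (hR : 0 < R) :
    θ * (1 - d / (2 * R)) ≤ 1 - min (θ * (d / 2) + (1 - θ) * R) d / R := by
  have h : min (θ * (d / 2) + (1 - θ) * R) d / R ≤ (θ * (d / 2) + (1 - θ) * R) / R := by
    gcongr
    exact min_le_left _ _
  have e : (θ * (d / 2) + (1 - θ) * R) / R = 1 - θ * (1 - d / (2 * R)) := by
    field_simp
    ring
  linarith

theorem min_radius_pos (hθ₀ : 0 < θ) (hθ₁ : θ ≤ 1) (hd : 0 < d) (hR : 0 < R) :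
    0 < min (θ * (d / 2) + (1 - θ) * R) d := by
  have : 0 ≤ (1 - θ) * R := mul_nonneg (by linarith) hR.le
  refine lt_min ?_ hd
  positivity

theorem min_radius_lt (hθ₀ : 0 < θ) (hR : 0 < R) (hs : d / (2 * R) < 1) :
    min (θ * (d / 2) + (1 - θ) * R) d < R := by
  have h := one_sub_min_radius_div (θ := θ) (d := d) hR
  have : 0 < θ * (1 - d / (2 * R)) := mul_pos hθ₀ (by linarith)
  exact (div_lt_one hR).1 (by linarith)

/-- For $s\le1/4$ the bound $r\le d=2sR$ gives $\log(R/r)\ge|\log s|-\log2\ge\frac12|\log s|$. For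
$s\ge1/4$, $\log(R/r)\ge1-r/R\ge\theta(1-s)$, while $|\log s|\le s^{-1}-1\le4(1-s)$. -/
theorem log_gap (hθ₀ : 0 < θ) (hθ₁ : θ ≤ 1) (hd : 0 < d) (hR : 0 < R) (hs : d / (2 * R) < 1) :
    θ / 4 * |Real.log (d / (2 * R))| ≤
      -Real.log (min (θ * (d / 2) + (1 - θ) * R) d) - -Real.log R := by
  have hr := min_radius_pos hθ₀ hθ₁ hd hR
  have hgap := one_sub_min_radius_div (θ := θ) (d := d) hR
  set r := min (θ * (d / 2) + (1 - θ) * R) d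
  set s := d / (2 * R) with hs_def
  have hs0 : 0 < s := by positivity
  have hlog : Real.log s < 0 := Real.log_neg hs0 hs
  have e : -Real.log r - -Real.log R = -Real.log (r / R) := by
    rw [Real.log_div hr.ne' hR.ne']
    ring
  rw [e, abs_of_neg hlog]
  rcases le_total s (1 / 4) with h4 | h4
  · have h1 : r / R ≤ 2 * s := by
      rw [hs_def, show 2 * (d / (2 * R)) = d / R by field_simp]
      gcongr
      exact min_le_right _ _
    have h2 : Real.log (r / R) ≤ Real.log (2 * s) := Real.log_le_log (by positivity) h1
    have h3 : Real.log (4 * s) ≤ 0 := Real.log_nonpos (by positivity) (by linarith)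
    have h5 : Real.log (2 * s) = Real.log 2 + Real.log s := Real.log_mul (by simp) hs0.ne'
    have h6 : Real.log (4 * s) = 2 * Real.log 2 + Real.log s := by
      rw [Real.log_mul (by simp) hs0.ne', show (4 : ℝ) = 2 ^ 2 by norm_num, Real.log_pow]
      norm_num
    nlinarith
  · have h1 : Real.log (r / R) ≤ r / R - 1 := Real.log_le_sub_one_of_pos (by positivity)
    have h2 : 1 - s⁻¹ ≤ Real.log s := Real.one_sub_inv_le_log_of_pos hs0
    have h3 : s⁻¹ - 1 ≤ 4 * (1 - s) := by
      rw [show s⁻¹ - 1 = s⁻¹ * (1 - s) by field_simp]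
      have : s⁻¹ ≤ 4 := by
        rw [inv_le_comm₀ hs0 (by norm_num)]
        linarith
      exact mul_le_mul_of_nonneg_right this (by linarith)
    nlinarith

/-- Write $r^{-1}-R^{-1}=r^{-1}(1-r/R)$ and use $r\le d$ in the first factor and
$1-r/R\ge\theta(1-s)$ in the second. The factor $1/4$ is not needed here; it matches the constant of
`log_gap`. -/
theorem inv_gap (hθ₀ : 0 < θ) (hθ₁ : θ ≤ 1) (hd : 0 < d) (hR : 0 < R) (hs : d / (2 * R) < 1) :
    θ / 4 * ((1 - d / (2 * R)) / d) ≤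
      (min (θ * (d / 2) + (1 - θ) * R) d)⁻¹ - R⁻¹ := by
  have hr := min_radius_pos hθ₀ hθ₁ hd hR
  have hrR := min_radius_lt hθ₀ hR hs
  have hgap := one_sub_min_radius_div (θ := θ) (d := d) hR
  have hrd : min (θ * (d / 2) + (1 - θ) * R) d ≤ d := min_le_right _ _
  set r := min (θ * (d / 2) + (1 - θ) * R) d
  have e : r⁻¹ - R⁻¹ = r⁻¹ * (1 - r / R) := by field_simp
  have h0 : 0 ≤ 1 - r / R := by
    have := (div_lt_one hR).2 hrR
    linarith
  have h1 : d⁻¹ * (1 - r / R) ≤ r⁻¹ - R⁻¹ := by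
    rw [e]
    gcongr
  refine le_trans ?_ h1
  rw [show θ / 4 * ((1 - d / (2 * R)) / d) = d⁻¹ * (θ * (1 - d / (2 * R)) / 4) by ring]
  have : 0 < θ * (1 - d / (2 * R)) := mul_pos hθ₀ (by linarith)
  gcongr
  linarith

end Radii

theorem exists_radialPotential_gap {n : ℕ} (hn : n = 2 ∨ n = 3) {θ : ℝ} (hθ₀ : 0 < θ)
    (hθ₁ : θ ≤ 1) : ∃ q : ℝ → ℝ, IsRadialPotential n q ∧ ∀ D F : Set (Space n),
      0 < Metric.diam (frontier F) → 0 < outerRadius D F → relSize D F < 1 →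
      (q (min (θ * (Metric.diam (frontier F) / 2) + (1 - θ) * outerRadius D F)
        (Metric.diam (frontier F))) - q (outerRadius D F))⁻¹ ≤
        4 / (2 * Real.pi * θ) * cBar D F ^ 2 := by
  rcases hn with rfl | rfl
  · refine ⟨_, isRadialPotential_two, fun D F hd hR hs => ?_⟩
    have h := log_gap hθ₀ hθ₁ hd hR hs
    have hw : 0 < |Real.log (relSize D F)| :=
      abs_pos.2 (Real.log_neg (div_pos hd (by positivity)) hs).ne
    rw [cBar, if_pos rfl, Real.sq_sqrt (by positivity)]
    calc _ ≤ (θ / 4 * |Real.log (relSize D F)|)⁻¹ := inv_anti₀ (by positivity) h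
      _ = _ := by field_simp
  · refine ⟨_, isRadialPotential_three, fun D F hd hR hs => ?_⟩
    have h := inv_gap hθ₀ hθ₁ hd hR hs
    have hw : 0 < 1 - relSize D F := by linarith
    rw [cBar, if_neg (by norm_num), Real.sq_sqrt (by positivity)]
    calc _ ≤ (θ / 4 * ((1 - relSize D F) / Metric.diam (frontier F)))⁻¹ :=
          inv_anti₀ (by positivity) h
      _ = _ := by field_simp

end Defeaturing

/-! ### Assembly. -/

theorem mainTheorem4 (n : ℕ) (hn : n = 2 ∨ n = 3) (θ : ℝ) (hθ₀ : 0 < θ) (hθ₁ : θ ≤ 1) :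
    ∃ c : ℝ, 0 < c ∧ ∀ D F : Set (Defeaturing.Space n),
      Defeaturing.IsInternalFeature D F →
      0 < Defeaturing.outerRadius D F →
      Defeaturing.relSize D F < 1 →
      closure F ⊆ Metric.closedBall (Defeaturing.barycenter F)
        (θ * (Metric.diam (frontier F) / 2) + (1 - θ) * Defeaturing.outerRadius D F) →
      Defeaturing.MemHHalfZero (D \ closure F) (frontier F) (fun _ => 1) ∧
      Defeaturing.naturalSeminorm (D \ closure F) ((frontier F).indicator fun _ => 1) ≤
        ENNReal.ofReal (c * Defeaturing.cBar D F) ∧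
      Defeaturing.naturalNorm (D \ closure F) ((frontier F).indicator fun _ => 1) ≤
        ENNReal.ofReal (c * √(1 + Defeaturing.outerRadius D F ^ 2) * Defeaturing.cBar D F) := by
  open Defeaturing in
  have hn1 : 1 ≤ n := by omega
  have : Nonempty (Fin n) := ⟨⟨0, hn1⟩⟩
  have : Nontrivial (Space n) := inferInstance
  obtain ⟨K, hK0, hK, hK'⟩ := exists_smoothTransition_bound
  obtain ⟨q, hq, hgap⟩ := exists_radialPotential_gap hn hθ₀ hθ₁
  set V : ℝ := n * volume.real (Metric.ball (0 : Space n) 1)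
  have hn0 : (0 : ℝ) < n := by exact_mod_cast hn1
  have hV0 : 0 < V := mul_pos hn0
    (ENNReal.toReal_pos (Metric.measure_ball_pos _ _ one_pos).ne' measure_ball_lt_top.ne)
  -- The sum $K^2+K$ covers both estimates: $K^2$ for the gradient and $K$ for the $L^2$ norm.
  set c2 : ℝ := V * (K ^ 2 + K) * (4 / (2 * Real.pi * θ))
  have hc0 : 0 < c2 := by positivity
  refine ⟨√c2, Real.sqrt_pos.2 hc0, fun D F hDF hR hs hF => ⟨memHHalfZero_one hn1 hDF, ?_⟩⟩
  have hFne : F.Nonempty := hDF.feature.isConnected.nonempty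
  have hFd := closure_subset_closedBall_barycenter hDF.feature.isOpen hDF.feature.isBounded hFne
  -- With zero diameter the nonempty open set $F$ would be a single point.
  have hd : 0 < Metric.diam (frontier F) := by
    by_contra! h
    have h1 : F ⊆ {barycenter F} := by
      rw [← Metric.closedBall_zero]
      exact (subset_closure.trans hFd).trans (Metric.closedBall_subset_closedBall h)
    obtain ⟨x, hx⟩ := hFne
    have h2 : IsOpen ({barycenter F} : Set (Space n)) := by
      have : F = {barycenter F} :=
        (subset_singleton_iff_eq.1 h1).resolve_left (Set.Nonempty.ne_empty ⟨x, hx⟩)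
      exact this ▸ hDF.feature.isOpen
    exact not_isOpen_singleton _ h2
  have hg := hgap D F hd hR hs
  have hr := min_radius_pos hθ₀ hθ₁ hd hR
  have hrR := min_radius_lt hθ₀ hR hs
  have hFr : closure F ⊆ Metric.closedBall (barycenter F)
      (min (θ * (Metric.diam (frontier F) / 2) + (1 - θ) * outerRadius D F)
        (Metric.diam (frontier F))) := fun x hx =>
    Metric.mem_closedBall.2 (le_min (Metric.mem_closedBall.1 (hF hx))
      (Metric.mem_closedBall.1 (hFd hx)))
  set r := min (θ * (Metric.diam (frontier F) / 2) + (1 - θ) * outerRadius D F)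
    (Metric.diam (frontier F))
  set R := outerRadius D F
  have hball : Metric.ball (barycenter F) R ⊆ D := by
    obtain ⟨x, hx⟩ := hFne
    exact ball_outerRadius_subset hDF.defeatured.isOpen (hDF.internal (subset_closure hx))
      (lt_of_le_of_lt (hFr (subset_closure hx)) hrR)
  obtain ⟨φ, hφs, hφc, hφ1, hφ0, hA, hB⟩ :=
    exists_capacitary_cutoff hq hK0 hK hK' hr hrR (barycenter F)
  have htr : EqOn φ ((frontier F).indicator fun _ => 1) (frontier (D \ closure F)) := by
    intro x hx
    by_cases hxF : x ∈ frontier F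
    · rw [indicator_of_mem hxF]
      exact hφ1 x (hFr (frontier_subset_closure hxF))
    · rw [indicator_of_notMem hxF]
      have hxD := (frontier_diff_closure_subset D F hx).resolve_right hxF
      rw [hDF.defeatured.isOpen.frontier_eq] at hxD
      exact hφ0 x fun h => hxD.2 (hball h)
  have hcb : 0 ≤ cBar D F := by
    unfold cBar
    split_ifs <;> positivity
  have hq0 : 0 ≤ (q r - q R)⁻¹ :=
    inv_nonneg.2 (sub_nonneg.2 (hq.strictAntiOn hr hR hrR).le)
  have hA2 : (√c2 * cBar D F) ^ 2 = c2 * cBar D F ^ 2 := by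
    rw [mul_pow, Real.sq_sqrt hc0.le]
  have hB2 : (√c2 * √(1 + R ^ 2) * cBar D F) ^ 2 = c2 * (1 + R ^ 2) * cBar D F ^ 2 := by
    rw [mul_pow, mul_pow, Real.sq_sqrt hc0.le, Real.sq_sqrt (by positivity)]
  refine natural_le_of_contDiff hφs hφc htr (by positivity) (by positivity) ?_ ?_
  · rw [hA2]
    calc _ ≤ V * (K ^ 2 / (q r - q R)) := hA
      _ = V * K ^ 2 * (q r - q R)⁻¹ := by ring
      _ ≤ V * (K ^ 2 + K) * (4 / (2 * Real.pi * θ) * cBar D F ^ 2) := by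
          gcongr
          exact le_add_of_nonneg_right hK0.le
      _ = _ := by ring
  · rw [hA2, hB2]
    calc _ ≤ V * (K * R ^ 2 / (q r - q R)) := hB
      _ = V * K * R ^ 2 * (q r - q R)⁻¹ := by ring
      _ ≤ V * (K ^ 2 + K) * R ^ 2 * (4 / (2 * Real.pi * θ) * cBar D F ^ 2) := by
          gcongr
          exact le_add_of_nonneg_left (sq_nonneg K)
      _ = _ := by ring
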